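/- A buyer with private value $v\sim F$ and a seller with private cost $c\sim G$, independent of $v$, can trade one item through an intermediary. Let $\bar v>0$ and $a\ge 1$ be real, and let $F$ be the distribution on $[0,\bar v]$ with CDF $F(v)=1-(1-v/\bar v)^a$ for $v\in[0,\bar v]$. Let $G$ be an arbitrary probability distribution concentrated on a Borel set $C\subseteq[0,\infty)$ of seller types (for instance $C=[0,\bar c]$). *Fee-setting.* In the mechanism with fee schedule $w$, the seller names a price $P$; if $v\ge P$ the item is traded, the buyer pays $P$, the intermediary keeps $w(P)$ and the seller receives $P-w(P)$; if $v<P$ nothing happens. A (measurable) strategy $P(\cdot)$ of the seller is a Bayes--Nash equilibrium if for every $c\in C$ the price $P(c)$ maximizes $q\mapsto \mathbb E_v[(q-w(q)-c)\mathbf 1\{v\ge q\}]$ over $q\in\mathbb R$. Its revenue is $\mathrm{Rev}(P)=\mathbb E_{v,c}[w(P(c))\mathbf 1\{v\ge P(c)\}]$. *Benchmarks.* $\mathrm{Surplus}=\mathbb E_{v,c}[(v-c)\mathbf 1\{v\ge c\}]$ is the maximum surplus. $\mathrm{OPT}$ is the supremum of the expected revenue (the buyer's payment minus the payment to the seller,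 under truthful reports) over all direct mechanisms with type spaces $[0,\bar v]$ and $C$, with trade probabilities in $[0,1]$ and with real payments of finite expectation, that are Bayesian incentive compatible and interim individually rational for buyer and seller. $\mathrm{OPT}^{\det}$ is the supremum over those among them whose allocations lie in $\{0,1\}$ and whose payments are nonnegative. Consider the affine fee schedule $$w(P)=\Bigl(1-\tfrac{a+1}{a}\Bigr)P+\tfrac{\bar v}{a}=\frac{\bar v-P}{a}.$$ The seller has a Bayes--Nash equilibrium strategy, and for every Bayes--Nash equilibrium strategy $P$ $$\mathrm{OPT}\le 4\,\mathrm{Rev}(P),\qquad \mathrm{Surplus}\le 8\,\mathrm{Rev}(P).$$ Consequently $\tfrac18\,\mathrm{Surplus}\le \mathrm{OPT}^{\det}\le \mathrm{OPT}$; in particular, for $a=1$, this holds for a buyer whose value is uniform on $[0,\bar v]$. -/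

import Mathlib

open MeasureTheory

namespace Exchange

/-! Single-item trade between a buyer with value `v` and a seller with cost `c`. The pair `(v, c)`
has law `F.prod G`, with `F` the law of `v` and `G` the law of `c`. The type spaces of the buyer and
of the seller are sets `V` and `C` of reals. -/

/-- The affine fee schedule `w(P) = (1 - α) P + β`. -/
def affineFee (α β : ℝ) : ℝ → ℝ := fun P => (1 - α) * P + β

/-- Expected utility, in the fee-setting mechanism with fee schedule `w`, of a seller with cost `c`
who asks for the price `P`: the buyer is charged `P` exactly if `P ≤ v`, and then the
seller receives `P - w P` and gives up the item. -/
noncomputable def sellerUtility (F : Measure ℝ) (w : ℝ → ℝ) (c P : ℝ) : ℝ :=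
  ∫ v, (if P ≤ v then P - w P - c else 0) ∂F

/-- `P` is a Bayes-Nash equilibrium strategy of the seller in the fee-setting mechanism with fee
schedule `w`: at every cost, the price is a best response. -/
def IsSellerBNE (F : Measure ℝ) (C : Set ℝ) (w P : ℝ → ℝ) : Prop :=
  Measurable P ∧ ∀ c ∈ C, ∀ q : ℝ, sellerUtility F w c q ≤ sellerUtility F w c (P c)

/-- Expected revenue of the intermediary in the fee-setting mechanism with fee schedule `w`
when the seller plays the strategy `P`. -/
noncomputable def feeRevenue (F G : Measure ℝ) (w P : ℝ → ℝ) : ℝ :=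
  ∫ z : ℝ × ℝ, (if P z.2 ≤ z.1 then w (P z.2) else 0) ∂(F.prod G)

/-- Maximum expected surplus: the item is traded exactly if `c ≤ v`. -/
noncomputable def optSurplus (F G : Measure ℝ) : ℝ :=
  ∫ z : ℝ × ℝ, (if z.2 ≤ z.1 then z.1 - z.2 else 0) ∂(F.prod G)

/-- A direct exchange mechanism. At the reports `v` of the buyer and `c` of the seller, the item is
traded with probability `alloc v c`, the buyer pays `charge v c` to the intermediary, and the
intermediary pays `pay v c` to the seller. -/
structure DirectMechanism where
  alloc : ℝ → ℝ → ℝ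
  charge : ℝ → ℝ → ℝ
  pay : ℝ → ℝ → ℝ
  alloc_mem : ∀ v c, alloc v c ∈ Set.Icc (0 : ℝ) 1
  measurable_alloc : Measurable fun z : ℝ × ℝ => alloc z.1 z.2
  measurable_charge : Measurable fun z : ℝ × ℝ => charge z.1 z.2
  measurable_pay : Measurable fun z : ℝ × ℝ => pay z.1 z.2

namespace DirectMechanism

/-- Interim utility of a buyer with value `v` who reports `b`, the seller being truthful. -/
noncomputable def buyerInterim (M : DirectMechanism) (G : Measure ℝ) (v b : ℝ) : ℝ :=
  ∫ c, (v * M.alloc b c - M.charge b c) ∂G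

/-- Interim utility of a seller with cost `c` who reports `b`, the buyer being truthful. -/
noncomputable def sellerInterim (M : DirectMechanism) (F : Measure ℝ) (c b : ℝ) : ℝ :=
  ∫ v, (M.pay v b - c * M.alloc v b) ∂F

/-- Expected payments, interim and ex ante, are finite. -/
structure HasFinitePayments (M : DirectMechanism) (F G : Measure ℝ) (V C : Set ℝ) : Prop where
  charge_interim : ∀ v ∈ V, Integrable (fun c => M.charge v c) G
  pay_interim : ∀ c ∈ C, Integrable (fun v => M.pay v c) F
  charge_total : Integrable (fun z : ℝ × ℝ => M.charge z.1 z.2) (F.prod G)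
  pay_total : Integrable (fun z : ℝ × ℝ => M.pay z.1 z.2) (F.prod G)

/-- Bayesian incentive compatibility: truthful reporting is a Bayes-Nash equilibrium. -/
def IsBIC (M : DirectMechanism) (F G : Measure ℝ) (V C : Set ℝ) : Prop :=
  (∀ v ∈ V, ∀ b ∈ V, M.buyerInterim G v b ≤ M.buyerInterim G v v) ∧
    ∀ c ∈ C, ∀ b ∈ C, M.sellerInterim F c b ≤ M.sellerInterim F c c

/-- Interim individual rationality. -/
def IsInterimIR (M : DirectMechanism) (F G : Measure ℝ) (V C : Set ℝ) : Prop :=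
  (∀ v ∈ V, 0 ≤ M.buyerInterim G v v) ∧ ∀ c ∈ C, 0 ≤ M.sellerInterim F c c

/-- The mechanisms over which the intermediary optimizes. -/
def IsAdmissible (M : DirectMechanism) (F G : Measure ℝ) (V C : Set ℝ) : Prop :=
  M.HasFinitePayments F G V C ∧ M.IsBIC F G V C ∧ M.IsInterimIR F G V C

/-- Allocations in `{0, 1}` and nonnegative payments. -/
def IsDeterministic (M : DirectMechanism) (V C : Set ℝ) : Prop :=
  ∀ v ∈ V, ∀ c ∈ C, (M.alloc v c = 0 ∨ M.alloc v c = 1) ∧ 0 ≤ M.charge v c ∧ 0 ≤ M.pay v c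

/-- Expected revenue of the intermediary under truthful reports. -/
noncomputable def revenue (M : DirectMechanism) (F G : Measure ℝ) : ℝ :=
  ∫ z : ℝ × ℝ, (M.charge z.1 z.2 - M.pay z.1 z.2) ∂(F.prod G)

end DirectMechanism

/-- Optimal revenue: the supremum of the expected revenue over all Bayesian incentive compatible,
interim individually rational mechanisms, lotteries and payments of either sign included. -/
noncomputable def optRevenue (F G : Measure ℝ) (V C : Set ℝ) : EReal :=
  ⨆ (M : DirectMechanism) (_ : M.IsAdmissible F G V C), ((M.revenue F G : ℝ) : EReal)

/-- The same supremum over the deterministic mechanisms with nonnegative payments only. -/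
noncomputable def optDetRevenue (F G : Measure ℝ) (V C : Set ℝ) : EReal :=
  ⨆ (M : DirectMechanism) (_ : M.IsAdmissible F G V C ∧ M.IsDeterministic V C),
    ((M.revenue F G : ℝ) : EReal)

end Exchange

/-! The fee is chosen so that the seller's share `P - w P` of a price `P` is the buyer's virtual
value φ(P), which is affine for the power law. Everything is then explicit. Put r = a/(a+1), A =
vbar/(a+1), and let x be the length of the part of [0, vbar] above the cost c, divided by vbar. At
cost c ≥ 0 the expected surplus is A x^(a+1), the profit of a monopolist with cost c is A r^a
x^(a+1), and the equilibrium fee revenue is A r^(2a+1) x^(a+1) (`optSurplus_eq`,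
`integral_monopoly_le`, `feeRevenue_eqPrice`). The ratios depend neither on c nor on G: they are
r^(-(2a+1)) ≤ 8 and r^(-(a+1)) ≤ 4, with equality at a = 1.

Expected monopoly profit bounds OPT. Incentive compatibility and individual rationality bound the
buyer's expected payment by the expected virtual value of the allocation (`integral_payment_le`),
while individual rationality of a seller of cost c makes the payment to him at least c times the
probability of trade. So revenue is at most the expectation of (φ(v) - c) times the allocation, and
the best allocation trades exactly if φ(v) ≥ c.

Conversely, the equilibrium outcome under this fee is itself an admissible deterministic direct
mechanism, so its revenue is a lower bound for the deterministic optimum. -/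

namespace Exchange

/-! ### The power distribution -/

/-- Survival function of the power distribution on `[0, vbar]` with exponent `a`. -/
noncomputable def powerTail (a vbar v : ℝ) : ℝ := (1 - v / vbar) ^ a

/-- Density of the power distribution on `[0, vbar]` with exponent `a`. -/
noncomputable def powerDensity (a vbar v : ℝ) : ℝ := a / vbar * (1 - v / vbar) ^ (a - 1)

/-- Virtual value of the buyer with power distribution. -/
noncomputable def virtualValue (a vbar v : ℝ) : ℝ := v - (vbar - v) / a

/-- Since `1 ≤ a`, the real power is differentiable even where its base vanishes, so the formula
holds on the whole line, endpoint `vbar` included. -/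
lemma hasDerivAt_powerTail {a vbar : ℝ} (ha : 1 ≤ a) (v : ℝ) :
    HasDerivAt (powerTail a vbar) (-powerDensity a vbar v) v := by
  have h1 : HasDerivAt (fun v : ℝ => 1 - v / vbar) (-(1 / vbar)) v := by
    simpa using ((hasDerivAt_id v).div_const vbar).const_sub 1
  have h2 := h1.rpow_const (p := a) (Or.inr ha)
  refine HasDerivAt.congr_deriv (f := powerTail a vbar) h2 ?_
  unfold powerDensity
  ring

lemma continuous_powerDensity {a vbar : ℝ} (ha : 1 ≤ a) : Continuous (powerDensity a vbar) := by
  unfold powerDensity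
  refine continuous_const.mul (Continuous.rpow_const (by fun_prop) fun v => Or.inr (by linarith))

lemma continuous_powerTail {a vbar : ℝ} (ha : 1 ≤ a) : Continuous (powerTail a vbar) :=
  continuous_iff_continuousAt.2 fun v => (hasDerivAt_powerTail ha v).continuousAt

lemma one_sub_div_nonneg {vbar v : ℝ} (hv : 0 < vbar) (h : v ≤ vbar) : 0 ≤ 1 - v / vbar := by
  rw [sub_nonneg, div_le_one hv]; exact h

lemma powerDensity_nonneg {a vbar v : ℝ} (ha : 1 ≤ a) (hv : 0 < vbar) (h : v ≤ vbar) :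
    0 ≤ powerDensity a vbar v := by
  have := one_sub_div_nonneg hv h
  unfold powerDensity
  positivity

lemma powerTail_nonneg {a vbar v : ℝ} (hv : 0 < vbar) (h : v ≤ vbar) :
    0 ≤ powerTail a vbar v := Real.rpow_nonneg (one_sub_div_nonneg hv h) a

lemma powerTail_zero {a vbar : ℝ} : powerTail a vbar 0 = 1 := by simp [powerTail]

lemma powerTail_top {a vbar : ℝ} (ha : 1 ≤ a) (hv : 0 < vbar) : powerTail a vbar vbar = 0 := by
  have : a ≠ 0 := by linarith
  simp [powerTail, div_self hv.ne', Real.zero_rpow this]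

/-- The defining property of a virtual value: v - φ(v) is the inverse hazard rate. The product form
survives at v = vbar, where tail and virtual value gap both vanish. -/
lemma sub_virtualValue_mul_powerDensity {a vbar v : ℝ} (ha : 1 ≤ a) (hv : 0 < vbar)
    (h : v ≤ vbar) :
    (v - virtualValue a vbar v) * powerDensity a vbar v = powerTail a vbar v := by
  have ha0 : a ≠ 0 := by linarith
  have h1 : (v - virtualValue a vbar v) * (a / vbar) = 1 - v / vbar := by
    unfold virtualValue; field_simp; ring
  unfold powerDensity powerTail
  rw [← mul_assoc, h1]
  rcases (one_sub_div_nonneg hv h).eq_or_lt with h0 | h0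
  · rw [← h0, zero_mul, Real.zero_rpow ha0]
  · rw [mul_comm, Real.rpow_sub_one h0.ne', div_mul_cancel₀ _ h0.ne']

lemma integral_powerDensity {a vbar : ℝ} (ha : 1 ≤ a) (p q : ℝ) :
    ∫ v in p..q, powerDensity a vbar v = powerTail a vbar p - powerTail a vbar q := by
  have := intervalIntegral.integral_eq_sub_of_hasDerivAt (a := p) (b := q)
    (f := fun v => -powerTail a vbar v) (f' := powerDensity a vbar)
    (fun v _ => (hasDerivAt_powerTail ha v).neg.congr_deriv (neg_neg _))
    ((continuous_powerDensity ha).intervalIntegrable _ _)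
  rw [this]; ring

/-- The law of the buyer's value, given by its density. -/
noncomputable def powerLaw (a vbar : ℝ) : Measure ℝ :=
  (volume.restrict (Set.Ioc 0 vbar)).withDensity fun v => ENNReal.ofReal (powerDensity a vbar v)

lemma powerLaw_Iic {a vbar : ℝ} (ha : 1 ≤ a) (hv : 0 < vbar) (x : ℝ) :
    powerLaw a vbar (Set.Iic x) =
      ENNReal.ofReal (1 - powerTail a vbar (max 0 (min x vbar))) := by
  have h0 : (0 : ℝ) ≤ max 0 (min x vbar) := le_max_left _ _
  have hle : max 0 (min x vbar) ≤ vbar := max_le hv.le (min_le_right _ _)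
  have hset : Set.Iic x ∩ Set.Ioc 0 vbar = Set.Ioc 0 (max 0 (min x vbar)) := by
    ext v
    simp only [Set.mem_inter_iff, Set.mem_Iic, Set.mem_Ioc, le_max_iff, le_min_iff]
    constructor
    · rintro ⟨h1, h2, h3⟩; exact ⟨h2, Or.inr ⟨h1, h3⟩⟩
    · rintro ⟨h1, h2 | h2⟩
      · linarith
      · exact ⟨h2.1, h1, h2.2⟩
  rw [powerLaw, withDensity_apply _ measurableSet_Iic, Measure.restrict_restrict measurableSet_Iic,
    hset, ← powerTail_zero (a := a) (vbar := vbar), ← integral_powerDensity ha,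
    intervalIntegral.integral_of_le h0, ofReal_integral_eq_lintegral_ofReal]
  · exact (((continuous_powerDensity ha).intervalIntegrable 0 _).1)
  · filter_upwards [ae_restrict_mem measurableSet_Ioc] with v hvm
    exact powerDensity_nonneg ha hv (hvm.2.trans hle)

/-- The cdf is 0 at 0 and 1 at `vbar`, so monotonicity and the bounds 0 and 1 determine it outside
the interval too. -/
lemma eq_powerLaw {a vbar : ℝ} (ha : 1 ≤ a) (hv : 0 < vbar) (F : Measure ℝ)
    [IsProbabilityMeasure F]
    (hF : ∀ v ∈ Set.Icc 0 vbar, ProbabilityTheory.cdf F v = 1 - (1 - v / vbar) ^ a) :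
    F = powerLaw a vbar := by
  refine Measure.ext_of_Iic _ _ fun x => ?_
  rw [powerLaw_Iic ha hv, ← ProbabilityTheory.ofReal_cdf]
  congr 1
  have h0 := hF 0 ⟨le_rfl, hv.le⟩
  have h1 := hF vbar ⟨hv.le, le_rfl⟩
  have e1 := powerTail_top ha hv
  have e0 : powerTail a vbar 0 = 1 := powerTail_zero
  rw [← powerTail] at h0 h1
  rw [e0] at h0
  rw [e1] at h1
  rcases le_total x 0 with hx | hx
  · rw [max_eq_left ((min_le_left _ _).trans hx), e0]
    refine le_antisymm ?_ (by rw [sub_self]; exact ProbabilityTheory.cdf_nonneg F x)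
    rw [← h0]; exact ProbabilityTheory.monotone_cdf F hx
  rcases le_total x vbar with hx' | hx'
  · rw [min_eq_left hx', max_eq_right hx, hF x ⟨hx, hx'⟩, powerTail]
  · rw [min_eq_right hx', max_eq_right hv.le, e1]
    refine le_antisymm (by rw [sub_zero]; exact ProbabilityTheory.cdf_le_one F x) ?_
    rw [← h1]; exact ProbabilityTheory.monotone_cdf F hx'

lemma ae_powerLaw_mem {a vbar : ℝ} : ∀ᵐ v ∂powerLaw a vbar, v ∈ Set.Ioc 0 vbar :=
  (withDensity_absolutelyContinuous _ _).ae_le (ae_restrict_mem measurableSet_Ioc)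

lemma integral_powerLaw {a vbar : ℝ} (ha : 1 ≤ a) (hv : 0 < vbar) (g : ℝ → ℝ) :
    ∫ v, g v ∂powerLaw a vbar = ∫ v in 0..vbar, g v * powerDensity a vbar v := by
  rw [powerLaw, integral_withDensity_eq_integral_toReal_smul
    (continuous_powerDensity ha).measurable.ennreal_ofReal (by simp),
    intervalIntegral.integral_of_le hv.le]
  refine setIntegral_congr_fun measurableSet_Ioc fun v hvm => ?_
  simp only [smul_eq_mul]
  rw [ENNReal.toReal_ofReal (powerDensity_nonneg ha hv hvm.2), mul_comm]

lemma intervalIntegrable_of_integrable_powerLaw {a vbar : ℝ} (ha : 1 ≤ a) (hv : 0 < vbar)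
    {g : ℝ → ℝ} (hg : Integrable g (powerLaw a vbar)) :
    IntervalIntegrable (fun v => g v * powerDensity a vbar v) volume 0 vbar := by
  rw [powerLaw, integrable_withDensity_iff_integrable_smul'
    (continuous_powerDensity ha).measurable.ennreal_ofReal (by simp)] at hg
  rw [intervalIntegrable_iff_integrableOn_Ioc_of_le hv.le]
  refine hg.congr ?_
  filter_upwards [ae_restrict_mem measurableSet_Ioc] with v hvm
  rw [smul_eq_mul, ENNReal.toReal_ofReal (powerDensity_nonneg ha hv hvm.2), mul_comm]

lemma integral_powerLaw_ite {a vbar p : ℝ} (ha : 1 ≤ a) (hv : 0 < vbar) (hp : p ∈ Set.Icc 0 vbar)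
    (g : ℝ → ℝ) :
    ∫ v, (if p ≤ v then g v else 0) ∂powerLaw a vbar =
      ∫ v in p..vbar, g v * powerDensity a vbar v := by
  rw [integral_powerLaw ha hv, intervalIntegral.integral_of_le hv.le,
    intervalIntegral.integral_of_le hp.2]
  have hset : Set.Ioc p vbar = Set.Ioc 0 vbar ∩ Set.Ioi p := by
    rw [Set.Ioc_inter_Ioi, max_eq_right hp.1]
  rw [hset, ← setIntegral_indicator measurableSet_Ioi]
  refine integral_congr_ae (ae_restrict_of_ae ?_)
  -- The law has no atoms, so `p ≤ v` and `p < v` may be exchanged.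
  filter_upwards [Measure.ae_ne volume p] with v hne
  by_cases h : p < v
  · simp [h, h.le]
  · have h' : ¬ p ≤ v := fun h' => h (lt_of_le_of_ne h' hne.symm)
    simp [h, h']

/-- The probability that the buyer accepts the price `p`, for `p` in the support. -/
lemma integral_powerLaw_ite_const {a vbar p : ℝ} (ha : 1 ≤ a) (hv : 0 < vbar)
    (hp : p ∈ Set.Icc 0 vbar) (k : ℝ) :
    ∫ v, (if p ≤ v then k else 0) ∂powerLaw a vbar = k * powerTail a vbar p := by
  rw [integral_powerLaw_ite ha hv hp (fun _ => k), intervalIntegral.integral_const_mul,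
    integral_powerDensity ha, powerTail_top ha hv, sub_zero]

lemma integral_powerLaw_ite_const_of_nonpos {a vbar p : ℝ} [IsProbabilityMeasure (powerLaw a vbar)]
    (hp : p ≤ 0) (k : ℝ) : ∫ v, (if p ≤ v then k else 0) ∂powerLaw a vbar = k := by
  have : ∀ᵐ v ∂powerLaw a vbar, (if p ≤ v then k else 0) = k := by
    filter_upwards [ae_powerLaw_mem] with v hvm
    rw [if_pos (hp.trans hvm.1.le)]
  rw [integral_congr_ae this]; simp

lemma integral_powerLaw_ite_const_of_ge {a vbar p : ℝ} (ha : 1 ≤ a) (hv : 0 < vbar)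
    (hp : vbar ≤ p) (k : ℝ) : ∫ v, (if p ≤ v then k else 0) ∂powerLaw a vbar = 0 := by
  rcases hp.eq_or_lt with rfl | hp
  · rw [integral_powerLaw_ite_const ha hv ⟨hv.le, le_rfl⟩, powerTail_top ha hv, mul_zero]
  · refine integral_eq_zero_of_ae ?_
    filter_upwards [ae_powerLaw_mem] with v hvm
    simp [not_le.2 (hvm.2.trans_lt hp)]

/-- Expected surplus of the trade with a seller of cost `c`. -/
lemma integral_powerLaw_surplus {a vbar c : ℝ} (ha : 1 ≤ a) (hv : 0 < vbar)
    (hc : c ∈ Set.Icc 0 vbar) :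
    ∫ v, (if c ≤ v then v - c else 0) ∂powerLaw a vbar =
      vbar / (a + 1) * (1 - c / vbar) ^ (a + 1) := by
  rw [integral_powerLaw_ite ha hv hc (fun v => v - c)]
  have ha1 : a + 1 ≠ 0 := by linarith
  -- Antiderivative from integration by parts: the tail with exponent a integrates to the tail with
  -- exponent a + 1, up to the factor -vbar/(a+1).
  have hd : ∀ v ∈ Set.uIcc c vbar, HasDerivAt
      (fun v => -((v - c) * powerTail a vbar v) - vbar / (a + 1) * powerTail (a + 1) vbar v)
      ((v - c) * powerDensity a vbar v) v := by
    intro v _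
    have h1 := ((((hasDerivAt_id v).sub_const c).mul (hasDerivAt_powerTail (vbar := vbar) ha v)).neg).sub
      ((hasDerivAt_powerTail (vbar := vbar) (show 1 ≤ a + 1 by linarith) v).const_mul
        (vbar / (a + 1)))
    refine h1.congr_deriv ?_
    simp only [powerDensity, powerTail, id, add_sub_cancel_right]
    field_simp
    ring
  rw [intervalIntegral.integral_eq_sub_of_hasDerivAt hd
    (((continuous_id.sub continuous_const).mul (continuous_powerDensity ha)).intervalIntegrable _ _),
    powerTail_top ha hv, powerTail_top (by linarith) hv, powerTail, powerTail]
  ring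

/-- Profit from the monopoly price of a seller with cost `c`. -/
lemma integral_powerLaw_monopoly {a vbar p : ℝ} (ha : 1 ≤ a) (hv : 0 < vbar)
    (hp : p ∈ Set.Icc 0 vbar) (c : ℝ) :
    ∫ v, (if p ≤ v then virtualValue a vbar v - c else 0) ∂powerLaw a vbar =
      (p - c) * powerTail a vbar p := by
  rw [integral_powerLaw_ite ha hv hp (fun v => virtualValue a vbar v - c)]
  have hd : ∀ v ∈ Set.uIcc p vbar, HasDerivAt (fun v => -((v - c) * powerTail a vbar v))
      ((virtualValue a vbar v - c) * powerDensity a vbar v) v := by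
    intro v hvm
    rw [Set.uIcc_of_le hp.2] at hvm
    have h1 := (((hasDerivAt_id v).sub_const c).mul
      (hasDerivAt_powerTail (vbar := vbar) ha v)).neg
    refine h1.congr_deriv ?_
    rw [← sub_virtualValue_mul_powerDensity ha hv hvm.2]
    simp only [id]
    ring
  have hcont : Continuous (virtualValue a vbar) := by unfold virtualValue; fun_prop
  rw [intervalIntegral.integral_eq_sub_of_hasDerivAt hd
    (((hcont.sub continuous_const).mul (continuous_powerDensity ha)).intervalIntegrable _ _),
    powerTail_top ha hv]
  ring

end Exchange
namespace Exchange

/-! ### Two inequalities for `(1 + 1 / a) ^ a` -/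

lemma one_le_eight_mul_rpow {a : ℝ} (ha : 1 ≤ a) : 1 ≤ 8 * (a / (a + 1)) ^ (2 * a + 1) := by
  have ha0 : 0 < a := by linarith
  have hs := (Real.hasSum_log_one_add_inv ha0).mul_left (2 * a + 1)
  have hs1 := (Real.hasSum_log_one_add_inv one_pos).mul_left (2 * 1 + 1 : ℝ)
  -- The factor 2a + 1 cancels one power of 1/(2a+1) in each term of the logarithm series, leaving
  -- even powers, which decrease in a. So a = 1 is the worst case.
  have hle : (2 * a + 1) * Real.log (1 + a⁻¹) ≤ (2 * 1 + 1) * Real.log (1 + 1⁻¹) := by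
    refine hasSum_le (fun k => ?_) hs hs1
    have key : ∀ b : ℝ, 1 ≤ b → (2 * b + 1) * (2 * (1 / (2 * (k : ℝ) + 1)) *
        (1 / (2 * b + 1)) ^ (2 * k + 1)) = 2 * (1 / (2 * (k : ℝ) + 1)) *
        (1 / (2 * b + 1)) ^ (2 * k) := by
      intro b hb
      have : 2 * b + 1 ≠ 0 := by linarith
      rw [pow_succ]
      field_simp
    rw [key a ha, key 1 le_rfl]
    gcongr
  have hlog8 : (2 * 1 + 1) * Real.log (1 + 1⁻¹) = Real.log 8 := by
    rw [show (8 : ℝ) = 2 ^ (3 : ℕ) by norm_num, Real.log_pow]; norm_num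
  have hr : a / (a + 1) = (1 + a⁻¹)⁻¹ := by field_simp
  have hpos : (0 : ℝ) < 1 + a⁻¹ := by positivity
  rw [hr, Real.inv_rpow hpos.le, ← div_eq_mul_inv, le_div_iff₀ (Real.rpow_pos_of_pos hpos _),
    one_mul, ← Real.log_le_log_iff (Real.rpow_pos_of_pos hpos _) (by norm_num),
    Real.log_rpow hpos, ← hlog8]
  exact hle

lemma one_le_four_mul_rpow {a : ℝ} (ha : 1 ≤ a) : 1 ≤ 4 * (a / (a + 1)) ^ (a + 1) := by
  have ha0 : 0 < a := by linarith
  have hr : 0 < a / (a + 1) := by positivity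
  have h8 := one_le_eight_mul_rpow ha
  have h2 : 1 ≤ 2 * (a / (a + 1)) := by
    rw [← mul_div_assoc, le_div_iff₀ (by linarith)]; linarith
  have hp : 0 < (a / (a + 1)) ^ (a + 1) := Real.rpow_pos_of_pos hr _
  have hsq : (a / (a + 1)) ^ (2 * a + 1) * (a / (a + 1)) = ((a / (a + 1)) ^ (a + 1)) ^ 2 := by
    rw [← Real.rpow_add_one hr.ne', pow_two, ← Real.rpow_add hr]; congr 1; ring
  -- Multiplying the bound with 8 by 1 ≤ 2r gives 1 ≤ 16 (r^(a+1))^2, then take the square root.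
  nlinarith [mul_le_mul h8 h2 zero_le_one (zero_le_one.trans h8)]

/-- Unique maximum of `t ↦ t ^ a * (a + 1 - a t)` at `t = 1`. -/
lemma rpow_mul_lt_one {a t : ℝ} (ha : 1 ≤ a) (ht : 0 ≤ t) (hne : t ≠ 1) :
    t ^ a * (a + 1 - a * t) < 1 := by
  rcases ht.eq_or_lt with rfl | ht
  · rw [Real.zero_rpow (by linarith)]; simp
  have hinv : 0 < t⁻¹ := inv_pos.2 ht
  -- Strict Bernoulli inequality at 1/t with exponent a + 1, to be multiplied by t^(a+1).
  have h := one_add_mul_self_lt_rpow_one_add (s := t⁻¹ - 1) (by linarith)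
    (by rw [sub_ne_zero]; simpa using hne) (p := a + 1) (by linarith)
  have hpos : 0 < t ^ a := Real.rpow_pos_of_pos ht _
  have hE : t ^ a * t * (1 + (t⁻¹ - 1)) ^ (a + 1) = 1 := by
    rw [add_sub_cancel, Real.inv_rpow ht.le, ← Real.rpow_add_one ht.ne',
      mul_inv_cancel₀ (Real.rpow_pos_of_pos ht _).ne']
  have hlt := mul_lt_mul_of_pos_left h (mul_pos hpos ht)
  rw [hE] at hlt
  calc t ^ a * (a + 1 - a * t) = t ^ a * t * (1 + (a + 1) * (t⁻¹ - 1)) := by field_simp; ring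
    _ < 1 := hlt

end Exchange
namespace Exchange

/-! ### The seller's best response -/

/-- The length of the interval of values in the support that exceed the cost. -/
noncomputable def gap (vbar c : ℝ) : ℝ := max (vbar - max c 0) 0

/-- The seller's equilibrium price. -/
noncomputable def eqPrice (a vbar c : ℝ) : ℝ := vbar - (a / (a + 1)) ^ 2 * gap vbar c

lemma gap_nonneg {vbar c : ℝ} : 0 ≤ gap vbar c := le_max_right _ _

lemma gap_le {vbar c : ℝ} (hv : 0 < vbar) : gap vbar c ≤ vbar :=
  max_le (by linarith [le_max_right c 0]) hv.le

lemma gap_eq_sub {vbar c : ℝ} (h0 : 0 ≤ c) (h : c ≤ vbar) : gap vbar c = vbar - c := by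
  rw [gap, max_eq_left h0, max_eq_left (by linarith)]

lemma gap_eq_zero {vbar c : ℝ} (h : vbar ≤ c) : gap vbar c = 0 :=
  max_eq_right (by linarith [le_max_left c 0])

lemma measurable_gap (vbar : ℝ) : Measurable (gap vbar) :=
  ((measurable_id.max measurable_const).const_sub vbar).max measurable_const

lemma measurable_eqPrice (a vbar : ℝ) : Measurable (eqPrice a vbar) :=
  ((measurable_gap vbar).const_mul _).const_sub _

lemma ratio_mem {a : ℝ} (ha : 1 ≤ a) : 0 < a / (a + 1) ∧ a / (a + 1) ≤ 1 :=
  ⟨by positivity, (div_le_one (by linarith)).2 (by linarith)⟩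

lemma sub_ratio_mul_gap_mem {vbar k : ℝ} (hv : 0 < vbar) (h0 : 0 ≤ k) (h1 : k ≤ 1) (c : ℝ) :
    vbar - k * gap vbar c ∈ Set.Icc 0 vbar := by
  have h := gap_nonneg (vbar := vbar) (c := c)
  have h' := gap_le (c := c) hv
  constructor <;> nlinarith

lemma eqPrice_mem {a vbar : ℝ} (ha : 1 ≤ a) (hv : 0 < vbar) (c : ℝ) :
    eqPrice a vbar c ∈ Set.Icc 0 vbar :=
  sub_ratio_mul_gap_mem hv (sq_nonneg _)
    (pow_le_one₀ (ratio_mem ha).1.le (ratio_mem ha).2) c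

lemma affineFee_eq {a vbar : ℝ} (ha : 1 ≤ a) (p : ℝ) :
    affineFee ((a + 1) / a) (vbar / a) p = (vbar - p) / a := by
  have : a ≠ 0 := by linarith
  unfold affineFee; field_simp; ring

lemma sub_affineFee_eq {a vbar : ℝ} (ha : 1 ≤ a) (p : ℝ) :
    p - affineFee ((a + 1) / a) (vbar / a) p = virtualValue a vbar p := by
  rw [affineFee_eq ha, virtualValue]

lemma virtualValue_mono {a vbar p q : ℝ} (ha : 1 ≤ a) (h : p ≤ q) :
    virtualValue a vbar p ≤ virtualValue a vbar q := by
  unfold virtualValue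
  gcongr

lemma virtualValue_le {a vbar p : ℝ} (ha : 1 ≤ a) (h : p ≤ vbar) :
    virtualValue a vbar p ≤ p := by
  have : 0 ≤ (vbar - p) / a := div_nonneg (by linarith) (by linarith)
  unfold virtualValue; linarith

/-- This is the payment to the seller upon trade, which must be nonnegative for the deterministic
benchmark. -/
lemma virtualValue_eqPrice_nonneg {a vbar : ℝ} (ha : 1 ≤ a) (hv : 0 < vbar) (c : ℝ) :
    0 ≤ virtualValue a vbar (eqPrice a vbar c) := by
  have ha0 : 0 < a := by linarith
  have h : virtualValue a vbar (eqPrice a vbar c) = vbar - a / (a + 1) * gap vbar c := by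
    unfold virtualValue eqPrice; field_simp; ring
  rw [h]
  exact (sub_ratio_mul_gap_mem hv (ratio_mem ha).1.le (ratio_mem ha).2 c).1

section Utility

variable {a vbar : ℝ}

lemma sellerUtility_of_mem (ha : 1 ≤ a) (hv : 0 < vbar) {q : ℝ} (hq : q ∈ Set.Icc 0 vbar)
    (c : ℝ) : sellerUtility (powerLaw a vbar) (affineFee ((a + 1) / a) (vbar / a)) c q =
      (virtualValue a vbar q - c) * powerTail a vbar q := by
  rw [sellerUtility, integral_powerLaw_ite_const ha hv hq, sub_affineFee_eq ha]

lemma sellerUtility_of_ge (ha : 1 ≤ a) (hv : 0 < vbar) {q : ℝ} (hq : vbar ≤ q) (c : ℝ) :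
    sellerUtility (powerLaw a vbar) (affineFee ((a + 1) / a) (vbar / a)) c q = 0 :=
  integral_powerLaw_ite_const_of_ge ha hv hq _

/-- Measuring the distance of the price from `vbar` in units of its equilibrium value reduces the
seller's problem, for all costs at once, to maximizing t^a (a + 1 - a t), with optimum t = 1. -/
lemma virtualValue_sub_mul_powerTail (ha : 1 ≤ a) (hv : 0 < vbar) {c t : ℝ} (hc : c ≤ vbar)
    (ht : 0 ≤ t) :
    (virtualValue a vbar (vbar - (a / (a + 1)) ^ 2 * (vbar - c) * t) - c) *
        powerTail a vbar (vbar - (a / (a + 1)) ^ 2 * (vbar - c) * t) =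
      (vbar - c) / (a + 1) * ((a / (a + 1)) ^ 2 * (vbar - c) / vbar) ^ a *
        (t ^ a * (a + 1 - a * t)) := by
  have ha0 : 0 < a := by linarith
  have h1 : virtualValue a vbar (vbar - (a / (a + 1)) ^ 2 * (vbar - c) * t) - c =
      (vbar - c) / (a + 1) * (a + 1 - a * t) := by
    unfold virtualValue; field_simp; ring
  have h2 : powerTail a vbar (vbar - (a / (a + 1)) ^ 2 * (vbar - c) * t) =
      ((a / (a + 1)) ^ 2 * (vbar - c) / vbar) ^ a * t ^ a := by
    have hn : 0 ≤ (a / (a + 1)) ^ 2 * (vbar - c) / vbar :=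
      div_nonneg (mul_nonneg (sq_nonneg _) (by linarith)) hv.le
    rw [powerTail, ← Real.mul_rpow hn ht]
    congr 1
    field_simp; ring
  rw [h1, h2]; ring

lemma ae_prod_mem (G : Measure ℝ) [SFinite G] :
    ∀ᵐ z ∂(powerLaw a vbar).prod G, z.1 ∈ Set.Ioc 0 vbar :=
  Measure.quasiMeasurePreserving_fst.ae ae_powerLaw_mem

lemma integrable_gap_rpow (ha : 1 ≤ a) (hv : 0 < vbar) (G : Measure ℝ) [IsFiniteMeasure G] :
    Integrable (fun c => (gap vbar c / vbar) ^ (a + 1)) G := by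
  refine Integrable.of_bound
    (((measurable_gap vbar).div_const vbar).pow_const (a + 1)).aestronglyMeasurable 1
    (Filter.Eventually.of_forall fun c => ?_)
  have h0 : 0 ≤ gap vbar c / vbar := div_nonneg gap_nonneg hv.le
  rw [Real.norm_of_nonneg (Real.rpow_nonneg h0 _)]
  exact Real.rpow_le_one h0 ((div_le_one hv).2 (gap_le hv)) (by linarith)

lemma sellerUtility_eqPrice_pos (ha : 1 ≤ a) (hv : 0 < vbar) {c : ℝ} (hc : 0 ≤ c)
    (hcv : c < vbar) : 0 < sellerUtility (powerLaw a vbar)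
      (affineFee ((a + 1) / a) (vbar / a)) c (eqPrice a vbar c) := by
  have h := virtualValue_sub_mul_powerTail ha hv hcv.le zero_le_one
  rw [mul_one, ← gap_eq_sub hc hcv.le, ← eqPrice] at h
  rw [sellerUtility_of_mem ha hv (eqPrice_mem ha hv c), h, gap_eq_sub hc hcv.le]
  have : 0 < vbar - c := by linarith
  have ha0 : 0 < a := by linarith
  simp only [Real.one_rpow, mul_one, add_sub_cancel_left]
  positivity

variable [IsProbabilityMeasure (powerLaw a vbar)]

lemma sellerUtility_neg_of_nonpos (ha : 1 ≤ a) (hv : 0 < vbar) {q c : ℝ} (hq : q ≤ 0)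
    (hc : 0 ≤ c) :
    sellerUtility (powerLaw a vbar) (affineFee ((a + 1) / a) (vbar / a)) c q < 0 := by
  rw [sellerUtility, integral_powerLaw_ite_const_of_nonpos hq, sub_affineFee_eq ha]
  have : 0 < (vbar - q) / a := div_pos (by linarith) (by linarith)
  unfold virtualValue; linarith

lemma sellerUtility_lt_eqPrice (ha : 1 ≤ a) (hv : 0 < vbar) {c q : ℝ} (hc : 0 ≤ c)
    (hcv : c < vbar) (hq : q ≠ eqPrice a vbar c) :
    sellerUtility (powerLaw a vbar) (affineFee ((a + 1) / a) (vbar / a)) c q <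
      sellerUtility (powerLaw a vbar) (affineFee ((a + 1) / a) (vbar / a)) c
        (eqPrice a vbar c) := by
  have hpos := sellerUtility_eqPrice_pos ha hv hc hcv
  rcases le_total q 0 with hq0 | hq0
  · exact (sellerUtility_neg_of_nonpos ha hv hq0 hc).trans hpos
  rcases le_total vbar q with hqv | hqv
  · rwa [sellerUtility_of_ge ha hv hqv]
  have hD : 0 < vbar - c := by linarith
  have ha0 : 0 < a := by linarith
  have hk : 0 < (a / (a + 1)) ^ 2 * (vbar - c) := by positivity
  obtain ⟨t, rfl⟩ : ∃ t, q = vbar - (a / (a + 1)) ^ 2 * (vbar - c) * t :=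
    ⟨(vbar - q) / ((a / (a + 1)) ^ 2 * (vbar - c)), by rw [mul_div_cancel₀ _ hk.ne']; ring⟩
  have ht : 0 ≤ t := by
    by_contra hneg
    nlinarith
  have ht1 : t ≠ 1 := by
    rintro rfl
    exact hq (by rw [eqPrice, gap_eq_sub hc hcv.le, mul_one])
  have h := virtualValue_sub_mul_powerTail ha hv hcv.le zero_le_one
  rw [mul_one, ← gap_eq_sub hc hcv.le, ← eqPrice, gap_eq_sub hc hcv.le] at h
  rw [sellerUtility_of_mem ha hv ⟨hq0, hqv⟩, sellerUtility_of_mem ha hv (eqPrice_mem ha hv c), h,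
    virtualValue_sub_mul_powerTail ha hv hcv.le ht]
  refine mul_lt_mul_of_pos_left ?_ (by positivity)
  simpa using rpow_mul_lt_one ha ht ht1

lemma sellerUtility_nonpos_of_ge_cost (ha : 1 ≤ a) (hv : 0 < vbar) {c q : ℝ} (hc : vbar ≤ c) :
    sellerUtility (powerLaw a vbar) (affineFee ((a + 1) / a) (vbar / a)) c q ≤ 0 := by
  rcases le_total q 0 with hq0 | hq0
  · exact (sellerUtility_neg_of_nonpos ha hv hq0 (hv.le.trans hc)).le
  rcases le_total vbar q with hqv | hqv
  · exact (sellerUtility_of_ge ha hv hqv c).le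
  · rw [sellerUtility_of_mem ha hv ⟨hq0, hqv⟩]
    exact mul_nonpos_of_nonpos_of_nonneg (by linarith [virtualValue_le ha hqv])
      (powerTail_nonneg hv hqv)

/-- Below `vbar` trade has positive probability and pays less than the cost, so such a price loses
to `vbar`, which yields 0. -/
lemma sellerUtility_neg_of_ge_cost (ha : 1 ≤ a) (hv : 0 < vbar) {c q : ℝ} (hc : vbar ≤ c)
    (hq : q < vbar) :
    sellerUtility (powerLaw a vbar) (affineFee ((a + 1) / a) (vbar / a)) c q < 0 := by
  rcases le_total q 0 with hq0 | hq0
  · exact sellerUtility_neg_of_nonpos ha hv hq0 (hv.le.trans hc)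
  · rw [sellerUtility_of_mem ha hv ⟨hq0, hq.le⟩]
    refine mul_neg_of_neg_of_pos (by linarith [virtualValue_le ha hq.le])
      (Real.rpow_pos_of_pos ?_ _)
    rw [sub_pos, div_lt_one hv]; exact hq

lemma isSellerBNE_eqPrice (ha : 1 ≤ a) (hv : 0 < vbar) {C : Set ℝ} (hC0 : C ⊆ Set.Ici 0) :
    IsSellerBNE (powerLaw a vbar) C (affineFee ((a + 1) / a) (vbar / a)) (eqPrice a vbar) := by
  refine ⟨measurable_eqPrice a vbar, fun c hc q => ?_⟩
  rcases lt_or_ge c vbar with hcv | hcv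
  · by_cases hq : q = eqPrice a vbar c
    · rw [hq]
    · exact (sellerUtility_lt_eqPrice ha hv (hC0 hc) hcv hq).le
  · rw [eqPrice, gap_eq_zero hcv, mul_zero, sub_zero, sellerUtility_of_ge ha hv le_rfl]
    exact sellerUtility_nonpos_of_ge_cost ha hv hcv

lemma IsSellerBNE.eq_eqPrice (ha : 1 ≤ a) (hv : 0 < vbar) {C : Set ℝ} (hC0 : C ⊆ Set.Ici 0)
    {P : ℝ → ℝ} (hP : IsSellerBNE (powerLaw a vbar) C (affineFee ((a + 1) / a) (vbar / a)) P)
    {c : ℝ} (hc : c ∈ C) (hcv : c < vbar) : P c = eqPrice a vbar c := by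
  by_contra hne
  exact (hP.2 c hc (eqPrice a vbar c)).not_gt (sellerUtility_lt_eqPrice ha hv (hC0 hc) hcv hne)

lemma IsSellerBNE.le_price (ha : 1 ≤ a) (hv : 0 < vbar) {C : Set ℝ}
    {P : ℝ → ℝ} (hP : IsSellerBNE (powerLaw a vbar) C (affineFee ((a + 1) / a) (vbar / a)) P)
    {c : ℝ} (hc : c ∈ C) (hcv : vbar ≤ c) : vbar ≤ P c := by
  by_contra! hlt
  have h := hP.2 c hc vbar
  rw [sellerUtility_of_ge ha hv le_rfl] at h
  exact h.not_gt (sellerUtility_neg_of_ge_cost ha hv hcv hlt)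

/-- On `C`, equilibria can differ only at costs c ≥ vbar, where the price is at least `vbar`. Trade
then requires P c = v = vbar, and the fee vanishes at `vbar`. -/
lemma IsSellerBNE.feeRevenue_eq (ha : 1 ≤ a) (hv : 0 < vbar) {C : Set ℝ} (hC0 : C ⊆ Set.Ici 0)
    {G : Measure ℝ} [IsProbabilityMeasure G] (hG : ∀ᵐ c ∂G, c ∈ C)
    {P : ℝ → ℝ} (hP : IsSellerBNE (powerLaw a vbar) C (affineFee ((a + 1) / a) (vbar / a)) P) :
    feeRevenue (powerLaw a vbar) G (affineFee ((a + 1) / a) (vbar / a)) P =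
      feeRevenue (powerLaw a vbar) G (affineFee ((a + 1) / a) (vbar / a)) (eqPrice a vbar) := by
  have hw : Measurable (affineFee ((a + 1) / a) (vbar / a)) := by unfold affineFee; fun_prop
  have hm : ∀ Q : ℝ → ℝ, Measurable Q → Measurable fun z : ℝ × ℝ =>
      if Q z.2 ≤ z.1 then affineFee ((a + 1) / a) (vbar / a) (Q z.2) else 0 := fun Q hQ =>
    Measurable.ite (measurableSet_le (hQ.comp measurable_snd) measurable_fst)
      (hw.comp (hQ.comp measurable_snd)) measurable_const
  have hset := measurableSet_eq_fun (hm P hP.1) (hm _ (measurable_eqPrice a vbar))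
  refine integral_congr_ae ((Measure.ae_prod_mem_iff_ae_ae_mem hset).2 ?_)
  rw [Measure.ae_ae_comm hset]
  filter_upwards [hG] with c hc
  filter_upwards [ae_powerLaw_mem] with v hvm
  change (if P c ≤ v then affineFee ((a + 1) / a) (vbar / a) (P c) else 0) =
    if eqPrice a vbar c ≤ v then affineFee ((a + 1) / a) (vbar / a) (eqPrice a vbar c) else 0
  rcases lt_or_ge c vbar with hcv | hcv
  · rw [hP.eq_eqPrice ha hv hC0 hc hcv]
  · have h1 := hP.le_price ha hv hc hcv
    have hz : affineFee ((a + 1) / a) (vbar / a) vbar = 0 := by rw [affineFee_eq ha]; simp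
    rw [eqPrice, gap_eq_zero hcv, mul_zero, sub_zero, hz, ite_self]
    split_ifs with h
    · rw [le_antisymm (h.trans hvm.2) h1, hz]
    · rfl

/-! ### Revenue, surplus and monopoly profit as functions of the cost -/

lemma feeRevenue_eqPrice (ha : 1 ≤ a) (hv : 0 < vbar) (G : Measure ℝ) [IsProbabilityMeasure G] :
    feeRevenue (powerLaw a vbar) G (affineFee ((a + 1) / a) (vbar / a)) (eqPrice a vbar) =
      vbar / (a + 1) * (a / (a + 1)) ^ (2 * a + 1) * ∫ c, (gap vbar c / vbar) ^ (a + 1) ∂G := by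
  have ha0 : 0 < a := by linarith
  have hw : Measurable (affineFee ((a + 1) / a) (vbar / a)) := by unfold affineFee; fun_prop
  rw [feeRevenue, integral_prod_symm, ← integral_const_mul]
  · refine integral_congr_ae (Filter.Eventually.of_forall fun c => ?_)
    simp only
    rw [integral_powerLaw_ite_const ha hv (eqPrice_mem ha hv c), affineFee_eq ha]
    have hr := (ratio_mem ha).1
    have hg : 0 ≤ gap vbar c / vbar := div_nonneg gap_nonneg hv.le
    have h1 : powerTail a vbar (eqPrice a vbar c) =
        (a / (a + 1)) ^ (2 * a) * (gap vbar c / vbar) ^ a := by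
      rw [show 2 * a = (2 : ℕ) * a by norm_num, Real.rpow_mul hr.le, Real.rpow_natCast,
        ← Real.mul_rpow (sq_nonneg _) hg, powerTail, eqPrice]
      congr 1
      field_simp; ring
    have h2 : (vbar - eqPrice a vbar c) / a = vbar / (a + 1) * (a / (a + 1)) *
        (gap vbar c / vbar) := by
      unfold eqPrice; field_simp; ring
    rw [h1, h2, Real.rpow_add_one hr.ne', Real.rpow_add_one' hg (by linarith)]
    ring
  · refine Integrable.of_bound (Measurable.aestronglyMeasurable ?_) (vbar / a)
      (Filter.Eventually.of_forall fun z => ?_)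
    · exact Measurable.ite (measurableSet_le ((measurable_eqPrice a vbar).comp measurable_snd)
        measurable_fst) (hw.comp ((measurable_eqPrice a vbar).comp measurable_snd))
        measurable_const
    · have h := eqPrice_mem ha hv z.2
      have h0 : 0 ≤ (vbar - eqPrice a vbar z.2) / a := div_nonneg (by linarith [h.2]) ha0.le
      split_ifs
      · rw [affineFee_eq ha, Real.norm_of_nonneg h0]
        gcongr; linarith [h.1]
      · rw [norm_zero]; positivity

lemma optSurplus_eq (ha : 1 ≤ a) (hv : 0 < vbar) (G : Measure ℝ) [IsProbabilityMeasure G]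
    (hG : ∀ᵐ c ∂G, 0 ≤ c) :
    optSurplus (powerLaw a vbar) G =
      vbar / (a + 1) * ∫ c, (gap vbar c / vbar) ^ (a + 1) ∂G := by
  rw [optSurplus, integral_prod_symm, ← integral_const_mul]
  · refine integral_congr_ae ?_
    filter_upwards [hG] with c hc
    rcases le_total c vbar with hcv | hcv
    · rw [integral_powerLaw_surplus ha hv ⟨hc, hcv⟩, gap_eq_sub hc hcv]
      congr 2
      field_simp
    · rw [gap_eq_zero hcv, zero_div, Real.zero_rpow (by linarith), mul_zero]
      refine integral_eq_zero_of_ae ?_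
      filter_upwards [ae_powerLaw_mem] with v hvm
      simp only [Pi.zero_apply, ite_eq_right_iff]
      intro h
      linarith [hvm.2]
  · refine Integrable.of_bound (Measurable.aestronglyMeasurable ?_) vbar ?_
    · exact Measurable.ite (measurableSet_le measurable_snd measurable_fst)
        (measurable_fst.sub measurable_snd) measurable_const
    · filter_upwards [ae_prod_mem (a := a) (vbar := vbar) G,
        Measure.quasiMeasurePreserving_snd.ae hG] with z h1 h2
      split_ifs with h
      · rw [Real.norm_of_nonneg (by linarith)]; linarith [h1.2]
      · rw [norm_zero]; exact hv.le

lemma optSurplus_le (ha : 1 ≤ a) (hv : 0 < vbar) (G : Measure ℝ) [IsProbabilityMeasure G]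
    (hG : ∀ᵐ c ∂G, 0 ≤ c) :
    optSurplus (powerLaw a vbar) G ≤ 8 *
      feeRevenue (powerLaw a vbar) G (affineFee ((a + 1) / a) (vbar / a)) (eqPrice a vbar) := by
  rw [optSurplus_eq ha hv G hG, feeRevenue_eqPrice ha hv G]
  have hI : 0 ≤ ∫ c, (gap vbar c / vbar) ^ (a + 1) ∂G :=
    integral_nonneg fun c => Real.rpow_nonneg (div_nonneg gap_nonneg hv.le) _
  have h : 0 ≤ vbar / (a + 1) * ∫ c, (gap vbar c / vbar) ^ (a + 1) ∂G :=
    mul_nonneg (div_nonneg hv.le (by linarith)) hI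
  nlinarith [mul_le_mul_of_nonneg_left (one_le_eight_mul_rpow ha) h]

lemma integral_monopoly_le (ha : 1 ≤ a) (hv : 0 < vbar) {x : ℝ → ℝ} (hx : Measurable x)
    (hx01 : ∀ v, x v ∈ Set.Icc (0 : ℝ) 1) {c : ℝ} (hc : 0 ≤ c) :
    ∫ v, (virtualValue a vbar v - c) * x v ∂powerLaw a vbar ≤
      vbar / (a + 1) * (a / (a + 1)) ^ a * (gap vbar c / vbar) ^ (a + 1) := by
  have ha0 : 0 < a := by linarith
  have hr := ratio_mem ha
  have hg : 0 ≤ gap vbar c / vbar := div_nonneg gap_nonneg hv.le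
  rcases le_total vbar c with hcv | hcv
  · refine (integral_nonpos_of_ae ?_).trans (by positivity)
    filter_upwards [ae_powerLaw_mem] with v hvm
    exact mul_nonpos_of_nonpos_of_nonneg (by linarith [virtualValue_le ha hvm.2, hvm.2])
      (hx01 v).1
  -- The monopoly price, the solution of φ(p) = c. As φ is increasing, φ(v) - c is nonnegative
  -- exactly for v ≥ p, so trading there is optimal pointwise.
  set p := vbar - a / (a + 1) * gap vbar c with hp
  have hpm : p ∈ Set.Icc 0 vbar := sub_ratio_mul_gap_mem hv hr.1.le hr.2 c
  have hφp : virtualValue a vbar p = c := by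
    rw [hp, virtualValue, gap_eq_sub hc hcv]; field_simp; ring
  have hval : (p - c) * powerTail a vbar p =
      vbar / (a + 1) * (a / (a + 1)) ^ a * (gap vbar c / vbar) ^ (a + 1) := by
    have h1 : powerTail a vbar p = (a / (a + 1)) ^ a * (gap vbar c / vbar) ^ a := by
      rw [powerTail, ← Real.mul_rpow hr.1.le hg]
      congr 1
      rw [hp]; field_simp; ring
    have h2 : p - c = vbar / (a + 1) * (gap vbar c / vbar) := by
      rw [hp, gap_eq_sub hc hcv]; field_simp; ring
    rw [h1, h2, Real.rpow_add_one' hg (by linarith)]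
    ring
  rw [← hval, ← integral_powerLaw_monopoly ha hv hpm]
  have hφ : Measurable (virtualValue a vbar) := by unfold virtualValue; fun_prop
  have hbd : ∀ v ∈ Set.Ioc 0 vbar, |virtualValue a vbar v - c| ≤ 2 * vbar := by
    intro v hvm
    have h1 := virtualValue_le ha hvm.2
    have h2 : (vbar - v) / a ≤ vbar := by
      rw [div_le_iff₀ ha0]; nlinarith [hvm.1]
    rw [abs_le]
    constructor
    · unfold virtualValue; linarith [hvm.1]
    · linarith [hvm.2]
  refine integral_mono_ae ?_ ?_ ?_
  · refine Integrable.of_bound ((hφ.sub_const c).mul hx).aestronglyMeasurable (2 * vbar) ?_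
    filter_upwards [ae_powerLaw_mem] with v hvm
    rw [norm_mul, Real.norm_of_nonneg (hx01 v).1]
    calc ‖virtualValue a vbar v - c‖ * x v ≤ 2 * vbar * 1 :=
          mul_le_mul (hbd v hvm) (hx01 v).2 (hx01 v).1 (by positivity)
      _ = 2 * vbar := mul_one _
  · refine Integrable.of_bound (Measurable.ite measurableSet_Ici (hφ.sub_const c)
      measurable_const).aestronglyMeasurable (2 * vbar) ?_
    filter_upwards [ae_powerLaw_mem] with v hvm
    split_ifs
    · exact hbd v hvm
    · rw [norm_zero]; positivity
  · refine Filter.Eventually.of_forall fun v => ?_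
    have h01 := hx01 v
    simp only
    split_ifs with h
    · have := virtualValue_mono (vbar := vbar) ha h
      nlinarith [h01.2]
    · have := virtualValue_mono (vbar := vbar) ha (not_le.1 h).le
      exact mul_nonpos_of_nonpos_of_nonneg (by linarith) h01.1

end Utility

end Exchange
namespace Exchange

/-! ### Myerson's bound on the buyer's payment -/

/-- Using the inequality in both directions traps U v - U s - (v - s) X s between 0 and (X v - X
s)(v - s), which is o(v - s) when X is continuous at s. -/
lemma hasDerivAt_of_subgradient {U X : ℝ → ℝ} {l r s : ℝ} (hs : s ∈ Set.Ioo l r)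
    (hsub : ∀ v ∈ Set.Icc l r, ∀ b ∈ Set.Icc l r, (v - b) * X b ≤ U v - U b)
    (hX : ContinuousWithinAt X (Set.Icc l r) s) : HasDerivAt U (X s) s := by
  have hnhds : Set.Icc l r ∈ nhds s := Icc_mem_nhds hs.1 hs.2
  have hXc : Filter.Tendsto (fun v => X v - X s) (nhds s) (nhds 0) := by
    have := (hX.continuousAt hnhds).tendsto.sub_const (X s)
    rwa [sub_self] at this
  rw [hasDerivAt_iff_isLittleO]
  have hO : (fun v => U v - U s - (v - s) • X s) =O[nhds s]
      fun v => (X v - X s) * (v - s) := by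
    refine Asymptotics.IsBigO.of_bound 1 ?_
    filter_upwards [hnhds] with v hv
    have h1 := hsub v hv s ⟨hs.1.le, hs.2.le⟩
    have h2 := hsub s ⟨hs.1.le, hs.2.le⟩ v hv
    rw [smul_eq_mul, one_mul, Real.norm_of_nonneg (by linarith), Real.norm_eq_abs]
    exact le_trans (by linarith) (le_abs_self _)
  refine hO.trans_isLittleO ?_
  have := (Asymptotics.isLittleO_one_iff ℝ).2 hXc
  simpa using this.mul_isBigO (Asymptotics.isBigO_refl (fun v => v - s) (nhds s))

/-- Under incentive compatibility and individual rationality, the buyer's expected payment is at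
most the expected virtual value of the allocation. -/
lemma integral_payment_le {a vbar : ℝ} (ha : 1 ≤ a) (hv : 0 < vbar) {X T : ℝ → ℝ}
    (hX : ∀ v, X v ∈ Set.Icc (0 : ℝ) 1)
    (hT : Integrable T (powerLaw a vbar))
    (hIC : ∀ v ∈ Set.Icc 0 vbar, ∀ b ∈ Set.Icc 0 vbar, v * X b - T b ≤ v * X v - T v)
    (hIR : ∀ v ∈ Set.Icc 0 vbar, 0 ≤ v * X v - T v) :
    ∫ v, T v ∂powerLaw a vbar ≤ ∫ v, virtualValue a vbar v * X v ∂powerLaw a vbar := by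
  set U : ℝ → ℝ := fun v => v * X v - T v with hU
  have hsub : ∀ v ∈ Set.Icc 0 vbar, ∀ b ∈ Set.Icc 0 vbar, (v - b) * X b ≤ U v - U b := by
    intro v hv b hb
    have := hIC v hv b hb
    simp only [hU]; linarith
  have hmono : MonotoneOn X (Set.Icc 0 vbar) := by
    intro b hb v hv hbv
    rcases hbv.eq_or_lt with rfl | hlt
    · exact le_rfl
    have h1 := hsub v hv b hb
    have h2 := hsub b hb v hv
    by_contra! h
    nlinarith [mul_pos (sub_pos.2 hlt) (sub_pos.2 h)]
  have hcontU : ContinuousOn U (Set.Icc 0 vbar) := by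
    refine (LipschitzOnWith.of_dist_le_mul (K := 1) fun v hv b hb => ?_).continuousOn
    have h1 := hsub v hv b hb
    have h2 := hsub b hb v hv
    have hb1 := hX b
    have hv1 := hX v
    rw [NNReal.coe_one, one_mul, Real.dist_eq, Real.dist_eq, abs_le]
    rcases le_total b v with h | h
    · rw [abs_of_nonneg (sub_nonneg.2 h)]
      constructor <;> nlinarith [hb1.1, hb1.2, hv1.1, hv1.2]
    · rw [abs_of_nonpos (sub_nonpos.2 h)]
      constructor <;> nlinarith [hb1.1, hb1.2, hv1.1, hv1.2]
  have huIcc : Set.uIcc 0 vbar = Set.Icc 0 vbar := Set.uIcc_of_le hv.le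
  have hXint : IntervalIntegrable X volume 0 vbar :=
    MonotoneOn.intervalIntegrable (by rwa [huIcc])
  have hXS : IntervalIntegrable (fun v => X v * powerTail a vbar v) volume 0 vbar :=
    hXint.mul_continuousOn (continuous_powerTail ha).continuousOn
  have hUf : IntervalIntegrable (fun v => U v * powerDensity a vbar v) volume 0 vbar :=
    (hcontU.mul (continuous_powerDensity ha).continuousOn).intervalIntegrable_of_Icc hv.le
  -- Envelope formula: X is monotone, hence U' = X off a countable set, and U is continuous.
  -- Integrating the derivative of U times the tail gives ∫ X S - ∫ U f = -U(0) ≤ 0, with S the tail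
  -- and f the density.
  have hftc := integral_eq_of_hasDerivAt_off_countable_of_le
    (fun v => U v * powerTail a vbar v)
    (fun v => X v * powerTail a vbar v - U v * powerDensity a vbar v) hv.le
    hmono.countable_not_continuousWithinAt
    (hcontU.mul (continuous_powerTail ha).continuousOn)
    (fun s hs => by
      have hcont : ContinuousWithinAt X (Set.Icc 0 vbar) s := by
        by_contra h
        exact hs.2 ⟨⟨hs.1.1.le, hs.1.2.le⟩, h⟩
      refine ((hasDerivAt_of_subgradient hs.1 hsub hcont).mul
        (hasDerivAt_powerTail ha s)).congr_deriv ?_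
      ring)
    (hXS.sub hUf)
  rw [intervalIntegral.integral_sub hXS hUf, powerTail_top ha hv, powerTail_zero] at hftc
  have hU0 : 0 ≤ U 0 := hIR 0 ⟨le_rfl, hv.le⟩
  have hφ : Continuous (virtualValue a vbar) := by unfold virtualValue; fun_prop
  have hTf := intervalIntegrable_of_integrable_powerLaw ha hv hT
  rw [integral_powerLaw ha hv, integral_powerLaw ha hv]
  have heq : ∫ v in 0..vbar, virtualValue a vbar v * X v * powerDensity a vbar v =
      ∫ v in 0..vbar, (T v * powerDensity a vbar v + U v * powerDensity a vbar v -
        X v * powerTail a vbar v) := by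
    refine intervalIntegral.integral_congr fun v hvm => ?_
    rw [huIcc] at hvm
    simp only [hU]
    rw [← sub_virtualValue_mul_powerDensity ha hv hvm.2]
    ring
  rw [heq, intervalIntegral.integral_sub (hTf.add hUf) hXS, intervalIntegral.integral_add hTf hUf]
  linarith

end Exchange
namespace Exchange

variable {a vbar : ℝ} [IsProbabilityMeasure (powerLaw a vbar)]

/-! ### Upper bound on the optimal revenue -/

namespace DirectMechanism

lemma integrable_alloc_left (M : DirectMechanism) (G : Measure ℝ) [IsFiniteMeasure G] (v : ℝ) :
    Integrable (fun c => M.alloc v c) G := by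
  refine Integrable.of_bound
    (M.measurable_alloc.comp measurable_prodMk_left).aestronglyMeasurable 1
    (Filter.Eventually.of_forall fun c => ?_)
  rw [Real.norm_of_nonneg (M.alloc_mem v c).1]
  exact (M.alloc_mem v c).2

lemma integrable_alloc_right (M : DirectMechanism) (F : Measure ℝ) [IsFiniteMeasure F] (c : ℝ) :
    Integrable (fun v => M.alloc v c) F := by
  refine Integrable.of_bound
    (M.measurable_alloc.comp measurable_prodMk_right).aestronglyMeasurable 1
    (Filter.Eventually.of_forall fun v => ?_)
  rw [Real.norm_of_nonneg (M.alloc_mem v c).1]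
  exact (M.alloc_mem v c).2

lemma integral_alloc_mem (M : DirectMechanism) (G : Measure ℝ) [IsProbabilityMeasure G] (v : ℝ) :
    ∫ c, M.alloc v c ∂G ∈ Set.Icc (0 : ℝ) 1 := by
  refine ⟨integral_nonneg fun c => (M.alloc_mem v c).1, ?_⟩
  have := integral_mono (M.integrable_alloc_left G v) (integrable_const (1 : ℝ))
    fun c => (M.alloc_mem v c).2
  simpa using this

lemma integrable_virtualValue_mul_alloc (M : DirectMechanism) (ha : 1 ≤ a) (hv : 0 < vbar)
    (G : Measure ℝ) [IsProbabilityMeasure G] :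
    Integrable (fun z : ℝ × ℝ => virtualValue a vbar z.1 * M.alloc z.1 z.2)
      ((powerLaw a vbar).prod G) := by
  have hφ : Measurable (virtualValue a vbar) := by unfold virtualValue; fun_prop
  refine Integrable.of_bound
    ((hφ.comp measurable_fst).mul M.measurable_alloc).aestronglyMeasurable vbar ?_
  filter_upwards [ae_prod_mem (a := a) (vbar := vbar) G] with z hz
  have hm := M.alloc_mem z.1 z.2
  have h1 := virtualValue_le ha hz.2
  have h2 : (vbar - z.1) / a ≤ vbar := by
    rw [div_le_iff₀ (by linarith)]; nlinarith [hz.1]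
  have h3 : |virtualValue a vbar z.1| ≤ vbar := by
    rw [abs_le]
    constructor
    · unfold virtualValue; linarith [hz.1]
    · linarith [hz.2]
  rw [norm_mul, Real.norm_of_nonneg hm.1]
  calc ‖virtualValue a vbar z.1‖ * M.alloc z.1 z.2 ≤ vbar * 1 :=
        mul_le_mul h3 hm.2 hm.1 hv.le
    _ = vbar := mul_one _

lemma integral_charge_le (M : DirectMechanism) (ha : 1 ≤ a) (hv : 0 < vbar) {C : Set ℝ}
    (G : Measure ℝ) [IsProbabilityMeasure G]
    (hM : M.IsAdmissible (powerLaw a vbar) G (Set.Icc 0 vbar) C) :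
    ∫ z : ℝ × ℝ, M.charge z.1 z.2 ∂(powerLaw a vbar).prod G ≤
      ∫ c, ∫ v, virtualValue a vbar v * M.alloc v c ∂powerLaw a vbar ∂G := by
  obtain ⟨hfin, hbic, hir⟩ := hM
  have hint : ∀ v, ∀ b ∈ Set.Icc 0 vbar, M.buyerInterim G v b =
      v * (∫ c, M.alloc b c ∂G) - ∫ c, M.charge b c ∂G := by
    intro v b hb
    rw [buyerInterim, integral_sub ((M.integrable_alloc_left G b).const_mul v)
      (hfin.charge_interim b hb), integral_const_mul]
  have hmain := integral_payment_le ha hv (X := fun v => ∫ c, M.alloc v c ∂G)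
    (T := fun v => ∫ c, M.charge v c ∂G) (fun v => M.integral_alloc_mem G v)
    hfin.charge_total.integral_prod_left
    (fun v hvm b hb => by
      have := hbic.1 v hvm b hb
      rwa [hint v b hb, hint v v hvm] at this)
    (fun v hvm => by
      have := hir.1 v hvm
      rwa [hint v v hvm] at this)
  have hI := M.integrable_virtualValue_mul_alloc ha hv G
  rw [integral_prod _ hfin.charge_total,
    ← integral_prod_symm (fun z : ℝ × ℝ => virtualValue a vbar z.1 * M.alloc z.1 z.2) hI,
    integral_prod _ hI]
  simpa only [integral_const_mul] using hmain

/-- For fixed c, the seller's participation constraint replaces the payment by c times the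
allocation; what remains is the monopoly problem at cost c. -/
lemma revenue_le (M : DirectMechanism) (ha : 1 ≤ a) (hv : 0 < vbar) {C : Set ℝ}
    (hC0 : C ⊆ Set.Ici 0) (G : Measure ℝ) [IsProbabilityMeasure G] (hG : ∀ᵐ c ∂G, c ∈ C)
    (hM : M.IsAdmissible (powerLaw a vbar) G (Set.Icc 0 vbar) C) :
    M.revenue (powerLaw a vbar) G ≤ vbar / (a + 1) * (a / (a + 1)) ^ a *
      ∫ c, (gap vbar c / vbar) ^ (a + 1) ∂G := by
  have hch := M.integral_charge_le ha hv G hM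
  obtain ⟨hfin, -, hir⟩ := hM
  have hI := M.integrable_virtualValue_mul_alloc ha hv G
  rw [revenue, integral_sub hfin.charge_total hfin.pay_total, integral_prod_symm _ hfin.pay_total]
  calc _ ≤ (∫ c, ∫ v, virtualValue a vbar v * M.alloc v c ∂powerLaw a vbar ∂G) -
        ∫ c, ∫ v, M.pay v c ∂powerLaw a vbar ∂G := by gcongr
    _ = ∫ c, ((∫ v, virtualValue a vbar v * M.alloc v c ∂powerLaw a vbar) -
        ∫ v, M.pay v c ∂powerLaw a vbar) ∂G :=
      (integral_sub hI.integral_prod_right hfin.pay_total.integral_prod_right).symm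
    _ ≤ ∫ c, vbar / (a + 1) * (a / (a + 1)) ^ a * (gap vbar c / vbar) ^ (a + 1) ∂G := by
      refine integral_mono_ae
        (hI.integral_prod_right.sub hfin.pay_total.integral_prod_right)
        ((integrable_gap_rpow ha hv G).const_mul _) ?_
      filter_upwards [hG, hI.prod_left_ae] with c hc hIc
      have hic := hir.2 c hc
      have hal := M.integrable_alloc_right (powerLaw a vbar) c
      rw [sellerInterim, integral_sub (hfin.pay_interim c hc) (hal.const_mul c)] at hic
      have hle := integral_monopoly_le ha hv (M.measurable_alloc.comp measurable_prodMk_right)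
        (fun v => M.alloc_mem v c) (hC0 hc)
      simp only [Function.comp_apply, sub_mul] at hle
      rw [integral_sub hIc (hal.const_mul c)] at hle
      linarith
    _ = _ := integral_const_mul _ _

end DirectMechanism

lemma optRevenue_le (ha : 1 ≤ a) (hv : 0 < vbar) {C : Set ℝ}
    (hC0 : C ⊆ Set.Ici 0) (G : Measure ℝ) [IsProbabilityMeasure G] (hG : ∀ᵐ c ∂G, c ∈ C) :
    optRevenue (powerLaw a vbar) G (Set.Icc 0 vbar) C ≤
      ((4 * feeRevenue (powerLaw a vbar) G (affineFee ((a + 1) / a) (vbar / a))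
        (eqPrice a vbar) : ℝ) : EReal) := by
  refine iSup₂_le fun M hM => EReal.coe_le_coe_iff.2 ?_
  refine (M.revenue_le ha hv hC0 G hG hM).trans ?_
  have hr := (ratio_mem ha).1
  have hI : 0 ≤ ∫ c, (gap vbar c / vbar) ^ (a + 1) ∂G :=
    integral_nonneg fun c => Real.rpow_nonneg (div_nonneg gap_nonneg hv.le) _
  have h : 0 ≤ vbar / (a + 1) * (a / (a + 1)) ^ a * ∫ c, (gap vbar c / vbar) ^ (a + 1) ∂G :=
    mul_nonneg (mul_nonneg (div_nonneg hv.le (by linarith)) (Real.rpow_nonneg hr.le _)) hI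
  -- Splitting the exponent exhibits fee revenue as the monopoly bound times r^(a+1), and 4 r^(a+1)
  -- ≥ 1.
  rw [feeRevenue_eqPrice ha hv G, show 2 * a + 1 = a + (a + 1) by ring, Real.rpow_add hr]
  nlinarith [mul_le_mul_of_nonneg_left (one_le_four_mul_rpow ha) h]

/-! ### The fee-setting mechanism as a direct mechanism -/

/-- The direct mechanism in which trade happens at the price `P c` whenever the buyer accepts it,
and the intermediary keeps `w (P c)`. -/
noncomputable def feeMechanism (w P : ℝ → ℝ) (hw : Measurable w) (hP : Measurable P) :
    DirectMechanism where
  alloc v c := if P c ≤ v then 1 else 0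
  charge v c := if P c ≤ v then P c else 0
  pay v c := if P c ≤ v then P c - w (P c) else 0
  alloc_mem v c := by split_ifs <;> simp
  measurable_alloc := Measurable.ite
    (measurableSet_le (hP.comp measurable_snd) measurable_fst) measurable_const measurable_const
  measurable_charge := Measurable.ite
    (measurableSet_le (hP.comp measurable_snd) measurable_fst) (hP.comp measurable_snd)
    measurable_const
  measurable_pay := Measurable.ite
    (measurableSet_le (hP.comp measurable_snd) measurable_fst)
    ((hP.comp measurable_snd).sub (hw.comp (hP.comp measurable_snd))) measurable_const

section FeeMechanism

variable {F G : Measure ℝ} {C : Set ℝ} {w P : ℝ → ℝ} (hw : Measurable w) (hP : Measurable P)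

lemma feeMechanism_revenue :
    (feeMechanism w P hw hP).revenue F G = feeRevenue F G w P := by
  refine integral_congr_ae (Filter.Eventually.of_forall fun z => ?_)
  simp only [feeMechanism]
  split_ifs <;> ring

lemma feeMechanism_sellerInterim (c b : ℝ) :
    (feeMechanism w P hw hP).sellerInterim F c b = sellerUtility F w c (P b) := by
  refine integral_congr_ae (Filter.Eventually.of_forall fun v => ?_)
  simp only [feeMechanism]
  split_ifs <;> ring

lemma feeMechanism_isDeterministic {V : Set ℝ} (hP0 : ∀ c, 0 ≤ P c)
    (hw0 : ∀ c, 0 ≤ P c - w (P c)) : (feeMechanism w P hw hP).IsDeterministic V C := by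
  intro v _ c _
  simp only [feeMechanism]
  split_ifs
  · exact ⟨Or.inr rfl, hP0 c, hw0 c⟩
  · exact ⟨Or.inl rfl, le_rfl, le_rfl⟩

/-- The buyer faces a price independent of his report, so truthfulness is optimal pointwise. A
seller's misreport b amounts to asking P b, which equilibrium rules out, and the price `p₀` serves
as his outside option. -/
lemma feeMechanism_isAdmissible [IsProbabilityMeasure F] [IsProbabilityMeasure G] {V : Set ℝ}
    {K p₀ : ℝ} (hPK : ∀ c, |P c| ≤ K) (hwK : ∀ c, |P c - w (P c)| ≤ K)
    (hBNE : IsSellerBNE F C w P) (hp₀ : ∀ c, 0 ≤ sellerUtility F w c p₀) :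
    (feeMechanism w P hw hP).IsAdmissible F G V C := by
  set M := feeMechanism w P hw hP with hM
  have hchK : ∀ v c, ‖M.charge v c‖ ≤ K := fun v c => by
    simp only [hM, feeMechanism]
    split_ifs
    · exact hPK c
    · rw [norm_zero]; exact (abs_nonneg _).trans (hPK c)
  have hpayK : ∀ v c, ‖M.pay v c‖ ≤ K := fun v c => by
    simp only [hM, feeMechanism]
    split_ifs
    · exact hwK c
    · rw [norm_zero]; exact (abs_nonneg _).trans (hPK c)
  have hch : ∀ v, Integrable (fun c => M.charge v c) G := fun v =>
    Integrable.of_bound (M.measurable_charge.comp measurable_prodMk_left).aestronglyMeasurable K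
      (Filter.Eventually.of_forall (hchK v))
  have hbi : ∀ v b, Integrable (fun c => v * M.alloc b c - M.charge b c) G := fun v b =>
    ((M.integrable_alloc_left G b).const_mul v).sub (hch b)
  refine ⟨⟨fun v _ => hch v, fun c _ => ?_, ?_, ?_⟩, ⟨fun v _ b _ => ?_, fun c hc b _ => ?_⟩,
    fun v _ => integral_nonneg fun c => ?_, fun c hc => ?_⟩
  · exact Integrable.of_bound
      (M.measurable_pay.comp measurable_prodMk_right).aestronglyMeasurable K
      (Filter.Eventually.of_forall fun v => hpayK v c)
  · exact Integrable.of_bound M.measurable_charge.aestronglyMeasurable K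
      (Filter.Eventually.of_forall fun z => hchK z.1 z.2)
  · exact Integrable.of_bound M.measurable_pay.aestronglyMeasurable K
      (Filter.Eventually.of_forall fun z => hpayK z.1 z.2)
  · refine integral_mono (hbi v b) (hbi v v) fun c => ?_
    simp only [hM, feeMechanism]
    split_ifs <;> linarith
  · rw [feeMechanism_sellerInterim, feeMechanism_sellerInterim]
    exact hBNE.2 c hc (P b)
  · simp only [hM, feeMechanism, Pi.zero_apply]
    split_ifs <;> linarith
  · rw [feeMechanism_sellerInterim]
    exact (hp₀ c).trans (hBNE.2 c hc p₀)

end FeeMechanism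

lemma feeRevenue_le_optDetRevenue (ha : 1 ≤ a) (hv : 0 < vbar) {C : Set ℝ}
    (hC0 : C ⊆ Set.Ici 0) (G : Measure ℝ) [IsProbabilityMeasure G] :
    ((feeRevenue (powerLaw a vbar) G (affineFee ((a + 1) / a) (vbar / a))
      (eqPrice a vbar) : ℝ) : EReal) ≤ optDetRevenue (powerLaw a vbar) G (Set.Icc 0 vbar) C := by
  have hw : Measurable (affineFee ((a + 1) / a) (vbar / a)) := by unfold affineFee; fun_prop
  have hP := measurable_eqPrice a vbar
  have hmem := eqPrice_mem ha hv
  have hφ0 := virtualValue_eqPrice_nonneg ha hv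
  rw [← feeMechanism_revenue hw hP]
  refine le_iSup₂_of_le (feeMechanism _ _ hw hP) ⟨?_, ?_⟩ le_rfl
  -- Asking `vbar` sells with probability 0, so it gives utility 0 at every cost.
  · refine feeMechanism_isAdmissible hw hP (K := vbar) (p₀ := vbar) (fun c => ?_) (fun c => ?_)
      (isSellerBNE_eqPrice ha hv hC0) (fun c => (sellerUtility_of_ge ha hv le_rfl c).ge)
    · rw [abs_of_nonneg (hmem c).1]; exact (hmem c).2
    · rw [sub_affineFee_eq ha, abs_of_nonneg (hφ0 c)]
      exact (virtualValue_le ha (hmem c).2).trans (hmem c).2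
  · exact feeMechanism_isDeterministic hw hP (fun c => (hmem c).1)
      fun c => by rw [sub_affineFee_eq ha]; exact hφ0 c

lemma optDetRevenue_le_optRevenue (F G : Measure ℝ) (V C : Set ℝ) :
    optDetRevenue F G V C ≤ optRevenue F G V C :=
  iSup₂_le fun M hM => le_iSup₂_of_le M hM.1 le_rfl

end Exchange

theorem mainTheorem6 (a vbar : ℝ) (ha : 1 ≤ a) (hv : 0 < vbar)
    (F : Measure ℝ) [IsProbabilityMeasure F]
    (hF : ∀ v ∈ Set.Icc 0 vbar, ProbabilityTheory.cdf F v = 1 - (1 - v / vbar) ^ a)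
    (C : Set ℝ) (hC : MeasurableSet C) (hC0 : C ⊆ Set.Ici 0)
    (G : Measure ℝ) [IsProbabilityMeasure G] (hG : ∀ᵐ c ∂G, c ∈ C) :
    (∃ P : ℝ → ℝ, Exchange.IsSellerBNE F C (Exchange.affineFee ((a + 1) / a) (vbar / a)) P) ∧
    (∀ P : ℝ → ℝ, Exchange.IsSellerBNE F C (Exchange.affineFee ((a + 1) / a) (vbar / a)) P →
      Exchange.optRevenue F G (Set.Icc 0 vbar) C ≤
          ((4 * Exchange.feeRevenue F G
            (Exchange.affineFee ((a + 1) / a) (vbar / a)) P : ℝ) : EReal) ∧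
        Exchange.optSurplus F G ≤
          8 * Exchange.feeRevenue F G (Exchange.affineFee ((a + 1) / a) (vbar / a)) P) ∧
    ((Exchange.optSurplus F G / 8 : ℝ) : EReal) ≤
        Exchange.optDetRevenue F G (Set.Icc 0 vbar) C ∧
    Exchange.optDetRevenue F G (Set.Icc 0 vbar) C ≤
        Exchange.optRevenue F G (Set.Icc 0 vbar) C := by
  obtain rfl := Exchange.eq_powerLaw ha hv F hF
  have hG0 : ∀ᵐ c ∂G, 0 ≤ c := hG.mono fun c hc => hC0 hc
  have hS := Exchange.optSurplus_le ha hv G hG0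
  refine ⟨⟨_, Exchange.isSellerBNE_eqPrice ha hv hC0⟩, fun P hP => ?_, ?_,
    Exchange.optDetRevenue_le_optRevenue _ _ _ _⟩
  · rw [hP.feeRevenue_eq ha hv hC0 hG]
    exact ⟨Exchange.optRevenue_le ha hv hC0 G hG, hS⟩
  · exact (EReal.coe_le_coe_iff.2 (by linarith)).trans
      (Exchange.feeRevenue_le_optDetRevenue ha hv hC0 G)
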